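/- Let $G$ be a countably infinite discrete amenable group, and let $\{F_n\}_{n\in\mathbb N}$ be a Følner sequence for $G$, i.e. each $F_n\subseteq G$ is finite and nonempty and $|F_n\bigtriangleup sF_n|/|F_n|\to 0$ for every $s\in G$. A $G$-system is a compact metric space on which $G$ acts by homeomorphisms. Let $X$ and $Y$ be $G$-systems and $\pi:Y\to X$ a factor map, i.e. a continuous surjection with $\pi(gy)=g\pi(y)$ for all $g\in G$, $y\in Y$. For a finite open cover $\mathcal U$ of a $G$-system $Z$, a finite set $F\subseteq G$ and $K\subseteq Z$, let $\mathcal U_F=\bigvee_{g\in F}g^{-1}\mathcal U$, let $N(\mathcal U_F,K)$ be the minimal cardinality of a subfamily of $\mathcal U_F$ covering $K$, and let $$h_{\mathrm{top}}(K,\{F_n\})=\sup_{\mathcal U}\limsup_{n\to\infty}\frac1{|F_n|}\log N(\mathcal U_{F_n},K),\qquad h_{\mathrm{top}}(Z,G)=h_{\mathrm{top}}(Z,\{F_n\}),$$ $$h_{\mathrm{top}}(G,Y|\pi)=\sup_{\mathcal U}\limsup_{n\to\infty}\frac1{|F_n|}\log\max_{x\in X}N(\mathcal U_{F_n},\pi^{-1}(x)),$$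 where $\mathcal U$ ranges over the finite open covers of $Z$, respectively of $Y$. (In the definitions of $h_{\mathrm{top}}(Z,G)$ and $h_{\mathrm{top}}(G,Y|\pi)$ the upper limits are limits, and do not depend on the Følner sequence, by the Ornstein–Weiss theorem.) Suppose that $h_{\mathrm{top}}(X,G)<\infty$. Then $$h_{\mathrm{top}}(Y,G)\le h_{\mathrm{top}}(X,G)+h_{\mathrm{top}}(G,Y|\pi).$$ Moreover, if $\{F_n\}$ is tempered, i.e. there is $C>0$ with $\bigl|\bigcup_{k<n}F_k^{-1}F_n\bigr|\le C|F_n|$ for all $n$, then for every nonempty compact subset $K\subseteq Y$ $$h_{\mathrm{top}}(K,\{F_n\})\le h_{\mathrm{top}}(\pi(K),\{F_n\})+h_{\mathrm{top}}(G,Y|\pi).$$ -/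

import Mathlib

open Filter Topology
open scoped Pointwise

namespace GSystem

noncomputable section

/-- A Følner sequence of `G`: nonempty finite sets `F n` with
`|F n ∆ s F n| / |F n| → 0` for every `s ∈ G`. -/
structure IsFolner {G : Type*} [Group G] (F : ℕ → Finset G) : Prop where
  nonempty : ∀ n, (F n).Nonempty
  tendsto : ∀ s : G,
    Tendsto (fun n => (Set.ncard (symmDiff (F n : Set G) (s • (F n : Set G))) : ℝ) / (F n).card)
      atTop (𝓝 0)

/-- A sequence of finite sets is tempered if `|⋃_{k < n} (F k)⁻¹ F n| ≤ C |F n|` for some `C > 0`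
and all `n` (for the first index the union is empty). -/
def IsTempered {G : Type*} [Group G] (F : ℕ → Finset G) : Prop :=
  ∃ C : ℝ, 0 < C ∧ ∀ n,
    (Set.ncard (⋃ k < n, ((F k : Set G)⁻¹ * (F n : Set G))) : ℝ) ≤ C * (F n).card

/-- A finite open cover of `X`. -/
structure IsFiniteOpenCover {X : Type*} [TopologicalSpace X] (U : Set (Set X)) : Prop where
  finite : U.Finite
  isOpen : ∀ u ∈ U, IsOpen u
  sUnion_eq : ⋃₀ U = Set.univ

/-- The family `U_F = ⋁_{g ∈ F} g⁻¹ U`, whose members are the intersections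
`⋂_{g ∈ F} g⁻¹ (u g)` with `u g ∈ U`. -/
def coverJoin {G X : Type*} [Group G] [MulAction G X] (U : Set (Set X)) (F : Finset G) :
    Set (Set X) :=
  {W | ∃ u : G → Set X, (∀ g ∈ F, u g ∈ U) ∧ W = ⋂ g ∈ F, (fun x : X => g • x) ⁻¹' u g}

/-- `N(U, K)`: the minimal cardinality of a subfamily of `U` which covers `K`. -/
def coverNumber {X : Type*} (U : Set (Set X)) (K : Set X) : ℕ :=
  sInf {n | ∃ V : Finset (Set X), (V : Set (Set X)) ⊆ U ∧ K ⊆ ⋃₀ (V : Set (Set X)) ∧ V.card = n}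

/-- `N(U | π) = max_x N(U, π⁻¹ x)`; for a finite cover `U` the values are bounded by `|U|`. -/
def fiberCoverNumber {X Y : Type*} (U : Set (Set Y)) (π : Y → X) : ℕ :=
  ⨆ x : X, coverNumber U (π ⁻¹' {x})

/-- `h_top(K, U, {F n}) = limsup_n log N(U_{F n}, K) / |F n|`. -/
def subsetCoverEntropy {G X : Type*} [Group G] [MulAction G X] (F : ℕ → Finset G)
    (U : Set (Set X)) (K : Set X) : EReal :=
  limsup (fun n => ((Real.log (coverNumber (coverJoin U (F n)) K) / (F n).card : ℝ) : EReal)) atTop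

/-- The topological entropy `h_top(K, {F n})` of a subset `K` along `{F n}`. -/
def subsetEntropy {G X : Type*} [Group G] [TopologicalSpace X] [MulAction G X]
    (F : ℕ → Finset G) (K : Set X) : EReal :=
  ⨆ (U : Set (Set X)) (_ : IsFiniteOpenCover U), subsetCoverEntropy F U K

/-- The topological entropy `h_top(X, G)`, computed along the Følner sequence `{F n}`:
the supremum over finite open covers `U` of the upper limit of `log N(U_{F n}) / |F n|`
(which is a limit independent of the Følner sequence, by the Ornstein-Weiss theorem). -/
def topEntropy {G : Type*} [Group G] (F : ℕ → Finset G) (X : Type*) [TopologicalSpace X]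
    [MulAction G X] : EReal :=
  subsetEntropy F (Set.univ : Set X)

/-- `h_top(G, U | π)`, computed along the Følner sequence `{F n}` as the upper limit of
`log N(U_{F n} | π) / |F n|` (again a limit independent of the Følner sequence). -/
def relCoverEntropy {G X Y : Type*} [Group G] [MulAction G Y] (F : ℕ → Finset G)
    (U : Set (Set Y)) (π : Y → X) : EReal :=
  limsup (fun n => ((Real.log (fiberCoverNumber (coverJoin U (F n)) π) / (F n).card : ℝ) : EReal))
    atTop

/-- The relative topological entropy `h_top(G, Y | π)`. -/
def relEntropy {G X Y : Type*} [Group G] [TopologicalSpace Y] [MulAction G Y]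
    (F : ℕ → Finset G) (π : Y → X) : EReal :=
  ⨆ (U : Set (Set Y)) (_ : IsFiniteOpenCover U), relCoverEntropy F U π

/-- A factor map of `G`-systems: a continuous equivariant surjection. -/
structure IsFactorMap (G : Type*) {X Y : Type*} [Group G] [TopologicalSpace X]
    [TopologicalSpace Y] [MulAction G X] [MulAction G Y] (π : Y → X) : Prop where
  continuous : Continuous π
  surjective : Function.Surjective π
  map_smul : ∀ (g : G) (y : Y), π (g • y) = g • π y

end

end GSystem

/-! Fix a cover `U` of `Y` and reals `a < b` with `a` above the relative entropy of `U`, so that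
late `F n` satisfy `log N(U_{F n} | π) ≤ a |F n|`. Quasi-tiling gives finitely many late shapes `F
n`, `n ∈ S`, whose right translates almost disjointly fill most of every late `F m`
(`IsFolner.exists_eventually_subadditive_le`). As `π` is closed and `X` compact, some cover `W` of
`X` has preimages no harder to cover by `U_{F n}`, `n ∈ S`, than the worst fibre
(`exists_cover_coverNumber_le`). For `w = ⋂ c⁻¹ (u c)` in `W_{F m}`, `c` maps `π⁻¹ w` into `π⁻¹ (u
c)`, so each tile `F n * {c}` costs at most `a |F n|`. Subadditivity gives `log N(U_{F m}, π⁻¹ w) ≤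
b |F m|`. Covering `K` over the members of `W_{F m}` yields the inequality for every `K`; the first
claim is `K = Y`. -/

namespace GSystem

/-! ### Quasi-tilings of almost invariant finite sets. -/

section Quasitiling

variable {G : Type*} [Group G] [DecidableEq G]

/-- Used to keep the remainder almost invariant after the tiles `B` are removed from `R`. -/
theorem card_smul_sdiff_sdiff_le (t : G) (R B : Finset G) :
    (t • (R \ B) \ (R \ B)).card ≤ (t • R \ R).card + (t • B \ B).card := by
  have h : t • (R \ B) \ (R \ B) ⊆ (t • R \ R) ∪ (B \ t • B) := by
    intro x hx
    rw [Finset.smul_finset_sdiff] at hx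
    simp only [Finset.mem_union, Finset.mem_sdiff] at hx ⊢
    tauto
  calc _ ≤ _ := Finset.card_le_card h
    _ ≤ _ := Finset.card_union_le _ _
    _ = _ := by rw [Finset.card_sdiff_comm (s := B) (t := t • B) (by simp)]

/-- Left translation commutes with right multiplication, so the boundary of `T * C` lies in the
boundary of `T` times `C`. -/
theorem card_smul_mul_sdiff_le (t : G) (T C : Finset G) :
    (t • (T * C) \ (T * C)).card ≤ C.card * (t • T \ T).card := by
  have h : t • (T * C) \ (T * C) ⊆ (t • T \ T) * C := by
    intro x hx
    rw [← smul_mul_assoc, Finset.mem_sdiff] at hx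
    obtain ⟨a, ha, c, hc, rfl⟩ := Finset.mem_mul.1 hx.1
    exact Finset.mul_mem_mul
      (Finset.mem_sdiff.2 ⟨ha, fun h => hx.2 (Finset.mul_mem_mul h hc)⟩) hc
  calc _ ≤ _ := Finset.card_le_card h
    _ ≤ _ := Finset.card_mul_le
    _ = _ := mul_comm _ _

/-- Greedy packing: a finite set `R` contains almost disjoint right translates of `T` whose union
fills at least the proportion `ε` of the set of `c ∈ R` with `T c ⊆ R`. -/
theorem exists_packing {T : Finset G} (hT : T.Nonempty) (R : Finset G) {ε : ℝ}
    (hε : 0 ≤ ε) (hε1 : ε ≤ 1) :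
    ∃ C ⊆ R, T * C ⊆ R ∧ (1 - ε) * (C.card * T.card) ≤ (T * C).card ∧
      ε * (R.card - ∑ t ∈ T, ((t • R \ R).card : ℝ)) ≤ (T * C).card := by
  have hTpos : (0 : ℝ) < T.card := by exact_mod_cast hT.card_pos
  let P := R.powerset.filter fun C =>
    T * C ⊆ R ∧ (1 - ε) * ((C.card : ℝ) * T.card) ≤ (T * C).card
  have hP : P.Nonempty := ⟨∅, by simp [P]⟩
  obtain ⟨C, hC, hmax⟩ := P.exists_max_image Finset.card hP
  simp only [P, Finset.mem_filter, Finset.mem_powerset] at hC hmax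
  refine ⟨C, hC.1, hC.2.1, hC.2.2, ?_⟩
  let core := R.filter fun c => T * {c} ⊆ R
  -- By maximality of `C`: a translate inside `R` with smaller overlap could still be added.
  have hcore : ∀ c ∈ core, ε * T.card ≤ ((T * {c} ∩ (T * C)).card : ℝ) := by
    intro c hc
    simp only [core, Finset.mem_filter] at hc
    have hcard : (T * {c}).card = T.card := by
      rw [Finset.card_mul_singleton]
    by_contra! hlt
    have hcC : c ∉ C := by
      intro hcC
      rw [Finset.inter_eq_left.2 (Finset.mul_subset_mul_left (by simpa using hcC)), hcard] at hlt
      nlinarith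
    have hun : T * insert c C = T * {c} ∪ T * C := by
      rw [Finset.insert_eq, Finset.mul_union]
    have hadd : ((T * insert c C).card : ℝ) + (T * {c} ∩ (T * C)).card
        = T.card + (T * C).card := by
      rw [hun, ← hcard]
      exact_mod_cast Finset.card_union_add_card_inter _ _
    have := hmax (insert c C) ⟨Finset.insert_subset hc.1 hC.1,
      by rw [hun]; exact Finset.union_subset hc.2 hC.2.1, by
        rw [Finset.card_insert_of_notMem hcC]
        push_cast
        linarith [hC.2.2]⟩
    rw [Finset.card_insert_of_notMem hcC] at this
    omega
  -- Double counting of the pairs `(t, c)` with `t * c ∈ T * C`; for fixed `t` the map `c ↦ t * c`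
  -- is injective.
  have hsum : ε * T.card * core.card ≤ T.card * (T * C).card := by
    have h1 : ∑ c ∈ core, (ε * T.card) ≤ ∑ c ∈ core, ((T * {c} ∩ (T * C)).card : ℝ) :=
      Finset.sum_le_sum hcore
    have h2 : ∑ c ∈ core, (T * {c} ∩ (T * C)).card ≤ T.card * (T * C).card := by
      calc ∑ c ∈ core, (T * {c} ∩ (T * C)).card
          ≤ ∑ c ∈ core, ∑ t ∈ T, if t * c ∈ T * C then 1 else 0 := by
            refine Finset.sum_le_sum fun c _ => ?_
            rw [← Finset.card_filter]
            refine (Finset.card_le_card (t := (T.filter fun t => t * c ∈ T * C).image (· * c))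
              fun x hx => ?_).trans Finset.card_image_le
            obtain ⟨hx1, hx2⟩ := Finset.mem_inter.1 hx
            obtain ⟨t, ht, d, hd, rfl⟩ := Finset.mem_mul.1 hx1
            obtain rfl := Finset.mem_singleton.1 hd
            exact Finset.mem_image.2 ⟨t, Finset.mem_filter.2 ⟨ht, hx2⟩, rfl⟩
        _ = ∑ t ∈ T, ∑ c ∈ core, if t * c ∈ T * C then 1 else 0 := Finset.sum_comm
        _ ≤ ∑ t ∈ T, (T * C).card := by
            refine Finset.sum_le_sum fun t _ => ?_
            rw [← Finset.card_filter]
            refine Finset.card_le_card_of_injOn (t * ·) (fun c hc => ?_) (by simp)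
            exact Finset.mem_coe.2 (Finset.mem_filter.1 hc).2
        _ = _ := by simp
    have h2' : ∑ c ∈ core, ((T * {c} ∩ (T * C)).card : ℝ) ≤ T.card * (T * C).card := by
      exact_mod_cast h2
    have h3 := h1.trans h2'
    rw [Finset.sum_const, nsmul_eq_mul] at h3
    linarith
  have hcore' : (R.card : ℝ) - ∑ t ∈ T, ((t • R \ R).card : ℝ) ≤ core.card := by
    have hsub : R \ core ⊆ T.biUnion fun t => R.filter fun c => t * c ∉ R := by
      intro c hc
      simp only [core, Finset.mem_sdiff, Finset.mem_filter, not_and, Finset.mem_biUnion] at hc ⊢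
      obtain ⟨x, hx, hxR⟩ := Finset.not_subset.1 (hc.2 hc.1)
      obtain ⟨t, ht, d, hd, rfl⟩ := Finset.mem_mul.1 hx
      obtain rfl := Finset.mem_singleton.1 hd
      exact ⟨t, ht, hc.1, hxR⟩
    have h1 : (R \ core).card ≤ ∑ t ∈ T, (t • R \ R).card := by
      refine (Finset.card_le_card hsub).trans (Finset.card_biUnion_le.trans
        (Finset.sum_le_sum fun t _ => ?_))
      refine Finset.card_le_card_of_injOn (t * ·) (fun c hc => ?_) (by simp)
      have hc := Finset.mem_filter.1 hc
      simp only [Finset.coe_sdiff, Set.mem_sdiff, Finset.mem_coe]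
      exact ⟨Finset.smul_mem_smul_finset (a := t) hc.1, hc.2⟩
    have h2 : (R \ core).card + core.card = R.card :=
      Finset.card_sdiff_add_card_eq_card (Finset.filter_subset _ _)
    have h3 : (R.card : ℝ) ≤ (∑ t ∈ T, (t • R \ R).card : ℕ) + core.card := by
      exact_mod_cast (by omega : R.card ≤ (∑ t ∈ T, (t • R \ R).card) + core.card)
    push_cast at h3
    linarith
  have h4 : ε * core.card ≤ (T * C).card := by
    refine le_of_mul_le_mul_left ?_ hTpos
    linarith
  exact (mul_le_mul_of_nonneg_left hcore' hε).trans h4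

theorem IsFolner.eventually_sum_card_le {F : ℕ → Finset G} (hF : IsFolner F) (T : Finset G)
    {δ : ℝ} (hδ : 0 < δ) :
    ∀ᶠ n in atTop, ∑ t ∈ T, ((t • F n \ F n).card : ℝ) ≤ δ * (F n).card := by
  have h : Tendsto (fun n => ∑ t ∈ T, (Set.ncard (symmDiff (F n : Set G) (t • (F n : Set G))) : ℝ)
      / (F n).card) atTop (𝓝 0) := by
    simpa using tendsto_finsetSum T fun t _ => hF.tendsto t
  filter_upwards [h.eventually_lt_const hδ] with n hn
  have hpos : (0 : ℝ) < (F n).card := by exact_mod_cast (hF.nonempty n).card_pos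
  rw [← Finset.sum_div, div_lt_iff₀ hpos] at hn
  refine le_trans (Finset.sum_le_sum fun t _ => ?_) hn.le
  rw [← Finset.coe_smul_finset, ← Finset.coe_symmDiff, Set.ncard_coe_finset]
  exact_mod_cast Finset.card_le_card fun x hx => by
    rw [Finset.mem_symmDiff]; exact Or.inr (Finset.mem_sdiff.1 hx)

theorem subadditive_mul_le {φ : Finset G → ℝ} (h0 : φ ∅ ≤ 0)
    (hadd : ∀ A B, φ (A ∪ B) ≤ φ A + φ B) {T C : Finset G} {b : ℝ}
    (hb : ∀ c ∈ C, φ (T * {c}) ≤ b) : φ (T * C) ≤ C.card * b := by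
  induction C using Finset.induction_on with
  | empty => simpa using h0
  | insert c C hc ih =>
    rw [Finset.insert_eq, Finset.mul_union, ← Finset.insert_eq, Finset.card_insert_of_notMem hc]
    have h1 := hadd (T * {c}) (T * C)
    have h2 := ih fun d hd => hb d (Finset.mem_insert_of_mem hd)
    have h3 := hb c (Finset.mem_insert_self c C)
    push_cast
    linarith

/-- Quasi-tiling with `k` shapes, in terms of subadditive functions. -/
theorem IsFolner.exists_shapes {F : ℕ → Finset G} (hF : IsFolner F) (n₀ : ℕ) {ε : ℝ}
    (hε : 0 < ε) (hε2 : ε ≤ 1 / 2) (k : ℕ) :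
    ∃ (S : Finset ℕ) (T : Finset G) (δ : ℝ), (∀ n ∈ S, n₀ ≤ n) ∧ 0 < δ ∧
      ∀ (R : Finset G) (φ : Finset G → ℝ) (a L : ℝ), 0 ≤ a → 0 ≤ L →
        ∑ t ∈ T, ((t • R \ R).card : ℝ) ≤ δ * R.card →
        (∀ A B, φ (A ∪ B) ≤ φ A + φ B) → (∀ A, φ A ≤ L * A.card) →
        (∀ n ∈ S, ∀ c ∈ R, φ (F n * {c}) ≤ a * (F n).card) →
        φ R ≤ (a * (1 + 2 * ε) + L * max ε ((1 - ε / 2) ^ k)) * R.card := by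
  induction k with
  | zero =>
    refine ⟨∅, ∅, 1, by simp, one_pos, fun R φ a L ha hL _ _ hφ _ => (hφ R).trans ?_⟩
    refine mul_le_mul_of_nonneg_right ?_ (Nat.cast_nonneg _)
    have : L * 1 ≤ L * max ε ((1 - ε / 2) ^ 0) :=
      mul_le_mul_of_nonneg_left (by simp) hL
    have : 0 ≤ a * (1 + 2 * ε) := by positivity
    linarith
  | succ k ih =>
    obtain ⟨S, T, δ, hS, hδ, hmain⟩ := ih
    have hδ' : 0 < δ * ε / 4 := by positivity
    -- The new shape is placed before the old ones, hence is chosen almost invariant under their set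
    -- `T`.
    obtain ⟨n, hn, hn₀⟩ :=
      ((hF.eventually_sum_card_le T hδ').and (eventually_ge_atTop n₀)).exists
    refine ⟨insert n S, T ∪ F n, min (1 / 2) (δ * ε / 4), ?_, by positivity, ?_⟩
    · intro m hm
      rcases Finset.mem_insert.1 hm with rfl | hm
      exacts [hn₀, hS m hm]
    intro R φ a L ha hL hR hadd hφ hφS
    have hRT : ∑ t ∈ T, ((t • R \ R).card : ℝ) ≤ δ * ε / 4 * R.card :=
      (Finset.sum_le_sum_of_subset_of_nonneg Finset.subset_union_left
        fun _ _ _ => Nat.cast_nonneg _).trans (hR.trans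
          (mul_le_mul_of_nonneg_right (min_le_right _ _) (Nat.cast_nonneg _)))
    have hRF : ∑ t ∈ F n, ((t • R \ R).card : ℝ) ≤ 1 / 2 * R.card :=
      (Finset.sum_le_sum_of_subset_of_nonneg Finset.subset_union_right
        fun _ _ _ => Nat.cast_nonneg _).trans (hR.trans
          (mul_le_mul_of_nonneg_right (min_le_left _ _) (Nat.cast_nonneg _)))
    obtain ⟨C, hCR, hBR, hC1, hC2⟩ := exists_packing (hF.nonempty n) R hε.le (by linarith)
    set B := F n * C with hB
    have hcardB : ((R \ B).card : ℝ) + B.card = R.card := by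
      exact_mod_cast Finset.card_sdiff_add_card_eq_card hBR
    have hB0 : (0 : ℝ) ≤ B.card := Nat.cast_nonneg _
    have hR0 : (0 : ℝ) ≤ R.card := Nat.cast_nonneg _
    have hR'0 : (0 : ℝ) ≤ (R \ B).card := Nat.cast_nonneg _
    have hCF : (C.card : ℝ) * (F n).card ≤ (1 + 2 * ε) * B.card := by
      have h0 : (0 : ℝ) ≤ C.card * (F n).card := by positivity
      have : (1 : ℝ) ≤ (1 + 2 * ε) * (1 - ε) := by nlinarith
      calc (C.card : ℝ) * (F n).card ≤ (1 + 2 * ε) * (1 - ε) * (C.card * (F n).card) :=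
            le_mul_of_one_le_left h0 this
        _ = (1 + 2 * ε) * ((1 - ε) * (C.card * (F n).card)) := by ring
        _ ≤ _ := mul_le_mul_of_nonneg_left hC1 (by positivity)
    -- Each round leaves at most the proportion `1 - ε / 2`, whence the power in the bound.
    have hB2 : ε / 2 * R.card ≤ B.card := by
      refine le_trans ?_ hC2
      have := mul_le_mul_of_nonneg_left hRF hε.le
      linarith
    have hφB : φ B ≤ a * (1 + 2 * ε) * B.card := by
      have h1 : φ B ≤ C.card * (a * (F n).card) :=
        subadditive_mul_le (by simpa using hφ ∅) hadd
          fun c hc => hφS n (Finset.mem_insert_self _ _) c (hCR hc)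
      have h2 := mul_le_mul_of_nonneg_left hCF ha
      linarith
    have hφR : φ R ≤ φ (R \ B) + φ B := by
      simpa [Finset.sdiff_union_of_subset hBR] using hadd (R \ B) B
    have ha2 : 0 ≤ a * (1 + 2 * ε) := by positivity
    set r := max ε ((1 - ε / 2) ^ k)
    set r' := max ε ((1 - ε / 2) ^ (k + 1))
    -- A large remainder is still `(T, δ)`-invariant, as the accumulated error is at most `3/4 * δ *
    -- ε * |R|`, and induction applies; a small one costs at most `L * ε * |R|`.
    rcases le_total (ε * R.card) ((R \ B).card : ℝ) with hcase | hcase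
    · have hinv : ∑ t ∈ T, ((t • (R \ B) \ (R \ B)).card : ℝ) ≤ δ * (R \ B).card := by
        have h1 : ∑ t ∈ T, ((t • (R \ B) \ (R \ B)).card : ℝ) ≤
            ∑ t ∈ T, ((t • R \ R).card : ℝ) + C.card * ∑ t ∈ T, ((t • F n \ F n).card : ℝ) := by
          rw [Finset.mul_sum, ← Finset.sum_add_distrib]
          refine Finset.sum_le_sum fun t _ => ?_
          exact_mod_cast (card_smul_sdiff_sdiff_le t R B).trans
            (Nat.add_le_add_left (card_smul_mul_sdiff_le t (F n) C) _)
        have h2 := mul_le_mul_of_nonneg_left hn (Nat.cast_nonneg (α := ℝ) C.card)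
        have h3 : δ * ε / 4 * (C.card * (F n).card) ≤ δ * ε / 4 * (2 * R.card) := by
          refine mul_le_mul_of_nonneg_left (hCF.trans ?_) hδ'.le
          nlinarith
        have h4 := mul_le_mul_of_nonneg_left hcase hδ.le
        have h5 : 0 ≤ δ * ε * R.card := by positivity
        linarith
      have hφR' := hmain (R \ B) φ a L ha hL hinv hadd hφ fun m hm c hc =>
        hφS m (Finset.mem_insert_of_mem hm) c (Finset.mem_sdiff.1 hc).1
      have hr : r * (1 - ε / 2) ≤ r' := by
        have h1 : (0 : ℝ) ≤ 1 - ε / 2 := by linarith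
        rw [max_mul_of_nonneg _ _ h1]
        refine max_le_max ?_ (by rw [pow_succ])
        nlinarith
      have hr0 : 0 ≤ r := hε.le.trans (le_max_left _ _)
      have h1 : r * (R \ B).card ≤ r' * R.card := by
        calc r * ((R \ B).card : ℝ) ≤ r * ((1 - ε / 2) * R.card) :=
              mul_le_mul_of_nonneg_left (by linarith) hr0
          _ = r * (1 - ε / 2) * R.card := by ring
          _ ≤ _ := mul_le_mul_of_nonneg_right hr hR0
      have h2 := mul_le_mul_of_nonneg_left h1 hL
      rw [← hcardB] at h2 ⊢
      linarith
    · have h1 := hφ (R \ B)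
      have h2 : ((R \ B).card : ℝ) ≤ r' * R.card :=
        hcase.trans (mul_le_mul_of_nonneg_right (le_max_left _ _) hR0)
      have h3 := mul_le_mul_of_nonneg_left h2 hL
      have h4 : a * (1 + 2 * ε) * B.card ≤ a * (1 + 2 * ε) * R.card :=
        mul_le_mul_of_nonneg_left (by linarith) ha2
      linarith

/-- A subadditive function on finite subsets which is at most `a |F n|` on the translates of
suitable Følner sets `F n` is at most about `a |F m|` on every sufficiently late `F m`. -/
theorem IsFolner.exists_eventually_subadditive_le {F : ℕ → Finset G} (hF : IsFolner F) (n₀ : ℕ)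
    {ε : ℝ} (hε : 0 < ε) (hε2 : ε ≤ 1 / 2) :
    ∃ S : Finset ℕ, (∀ n ∈ S, n₀ ≤ n) ∧
      ∀ᶠ m in atTop, ∀ (φ : Finset G → ℝ) (a L : ℝ), 0 ≤ a → 0 ≤ L →
        (∀ A B, φ (A ∪ B) ≤ φ A + φ B) → (∀ A, φ A ≤ L * A.card) →
        (∀ n ∈ S, ∀ c ∈ F m, φ (F n * {c}) ≤ a * (F n).card) →
        φ (F m) ≤ (a * (1 + 2 * ε) + L * ε) * (F m).card := by
  obtain ⟨k, hk⟩ := exists_pow_lt_of_lt_one hε (by linarith : 1 - ε / 2 < 1)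
  obtain ⟨S, T, δ, hS, hδ, h⟩ := hF.exists_shapes n₀ hε hε2 k
  refine ⟨S, hS, ?_⟩
  filter_upwards [hF.eventually_sum_card_le T hδ] with m hm φ a L ha hL hadd hφ hφS
  simpa [max_eq_left hk.le] using h (F m) φ a L ha hL hm hadd hφ hφS

end Quasitiling

/-! ### Cover numbers, fibres and joins. -/

section Covers

variable {X Y : Type*}

theorem coverNumber_le {U : Set (Set X)} {K : Set X} (V : Finset (Set X))
    (hV : (V : Set (Set X)) ⊆ U) (hK : K ⊆ ⋃₀ (V : Set (Set X))) : coverNumber U K ≤ V.card :=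
  Nat.sInf_le ⟨V, hV, hK, rfl⟩

theorem exists_card_eq_coverNumber {U : Set (Set X)} (hU : U.Finite) (hc : ⋃₀ U = Set.univ)
    (K : Set X) : ∃ V : Finset (Set X), (V : Set (Set X)) ⊆ U ∧ K ⊆ ⋃₀ (V : Set (Set X)) ∧
      V.card = coverNumber U K :=
  Nat.sInf_mem (s := {n | ∃ V : Finset (Set X), (V : Set (Set X)) ⊆ U ∧
    K ⊆ ⋃₀ (V : Set (Set X)) ∧ V.card = n})
    ⟨_, hU.toFinset, by simp, by simp [hc], rfl⟩

theorem coverNumber_le_ncard {U : Set (Set X)} (hU : U.Finite) (hc : ⋃₀ U = Set.univ)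
    (K : Set X) : coverNumber U K ≤ U.ncard := by
  rw [Set.ncard_eq_toFinset_card U hU]
  exact coverNumber_le _ (by simp) (by simp [hc])

theorem coverNumber_le_of_preimage {U : Set (Set Y)} {V : Set (Set X)} (hV : V.Finite)
    (hc : ⋃₀ V = Set.univ) (f : Y → X) (h : ∀ v ∈ V, ∃ u ∈ U, f ⁻¹' v ⊆ u)
    {K : Set Y} {K' : Set X} (hK : K ⊆ f ⁻¹' K') : coverNumber U K ≤ coverNumber V K' := by
  classical
  obtain ⟨W, hWV, hKW, hcard⟩ := exists_card_eq_coverNumber hV hc K'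
  choose! p hpU hp using h
  rw [← hcard]
  refine (coverNumber_le (W.image p) ?_ ?_).trans Finset.card_image_le
  · intro u hu
    obtain ⟨v, hv, rfl⟩ := Finset.mem_image.1 (Finset.mem_coe.1 hu)
    exact hpU v (hWV hv)
  · intro y hy
    obtain ⟨v, hv, hyv⟩ := hKW (hK hy)
    exact ⟨p v, Finset.mem_coe.2 (Finset.mem_image_of_mem p hv), hp v (hWV hv) hyv⟩

theorem coverNumber_le_mul {U V Z : Set (Set X)} (hU : U.Finite) (hUc : ⋃₀ U = Set.univ)
    (hV : V.Finite) (hVc : ⋃₀ V = Set.univ) (h : ∀ u ∈ U, ∀ v ∈ V, ∃ z ∈ Z, u ∩ v ⊆ z)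
    (K : Set X) : coverNumber Z K ≤ coverNumber U K * coverNumber V K := by
  classical
  obtain ⟨A, hAU, hKA, hA⟩ := exists_card_eq_coverNumber hU hUc K
  obtain ⟨B, hBV, hKB, hB⟩ := exists_card_eq_coverNumber hV hVc K
  choose! p hpZ hp using h
  rw [← hA, ← hB, ← Finset.card_product]
  refine (coverNumber_le ((A ×ˢ B).image fun q => p q.1 q.2) ?_ ?_).trans Finset.card_image_le
  · intro z hz
    obtain ⟨q, hq, rfl⟩ := Finset.mem_image.1 (Finset.mem_coe.1 hz)
    have hq := Finset.mem_product.1 hq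
    exact hpZ _ (hAU hq.1) _ (hBV hq.2)
  · intro x hx
    obtain ⟨u, hu, hxu⟩ := hKA hx
    obtain ⟨v, hv, hxv⟩ := hKB hx
    exact ⟨p u v, Finset.mem_coe.2 (Finset.mem_image.2
      ⟨(u, v), Finset.mem_product.2 ⟨hu, hv⟩, rfl⟩), hp u (hAU hu) v (hBV hv) ⟨hxu, hxv⟩⟩

/-- Covering `K` member by member of a cover `V` of `π '' K`. -/
theorem coverNumber_le_mul_of_preimage {U : Set (Set Y)} {V : Set (Set X)} (hU : U.Finite)
    (hUc : ⋃₀ U = Set.univ) (hV : V.Finite) (hVc : ⋃₀ V = Set.univ) (π : Y → X) {M : ℕ}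
    (h : ∀ v ∈ V, coverNumber U (π ⁻¹' v) ≤ M) (K : Set Y) :
    coverNumber U K ≤ coverNumber V (π '' K) * M := by
  classical
  obtain ⟨A, hAV, hKA, hA⟩ := exists_card_eq_coverNumber hV hVc (π '' K)
  choose p hpU hp hpc using fun v : Set X => exists_card_eq_coverNumber hU hUc (π ⁻¹' v)
  rw [← hA]
  refine (coverNumber_le (A.biUnion p) ?_ ?_).trans
    (Finset.card_biUnion_le_card_mul _ _ _ fun v hv => (hpc v).trans_le (h v (hAV hv)))
  · intro u hu
    obtain ⟨v, -, hu⟩ := Finset.mem_biUnion.1 (Finset.mem_coe.1 hu)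
    exact hpU v hu
  · intro y hy
    obtain ⟨v, hv, hyv⟩ := hKA (Set.mem_image_of_mem π hy)
    obtain ⟨u, hu, hyu⟩ := hp v hyv
    exact ⟨u, Finset.mem_coe.2 (Finset.mem_biUnion.2 ⟨v, hv, hu⟩), hyu⟩

theorem coverNumber_le_fiberCoverNumber {U : Set (Set Y)} (hU : U.Finite)
    (hUc : ⋃₀ U = Set.univ) (π : Y → X) (x : X) :
    coverNumber U (π ⁻¹' {x}) ≤ fiberCoverNumber U π :=
  -- An unbounded supremum in `ℕ` would be `0`; the bound by `U.ncard` excludes this.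
  le_ciSup (f := fun x => coverNumber U (π ⁻¹' {x}))
    ⟨U.ncard, by rintro _ ⟨x, rfl⟩; exact coverNumber_le_ncard hU hUc _⟩ x

/-- A closed map has, around every point, a neighbourhood whose preimage is not harder to cover
than the fibre. -/
theorem exists_isOpen_coverNumber_le [TopologicalSpace X] [TopologicalSpace Y] {π : Y → X}
    (hπ : IsClosedMap π) {U : Set (Set Y)} (hU : IsFiniteOpenCover U) (x : X) :
    ∃ O : Set X, IsOpen O ∧ x ∈ O ∧ coverNumber U (π ⁻¹' O) ≤ fiberCoverNumber U π := by
  obtain ⟨V, hVU, hxV, hV⟩ := exists_card_eq_coverNumber hU.finite hU.sUnion_eq (π ⁻¹' {x})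
  have hopen : IsOpen (⋃₀ (V : Set (Set Y))) := isOpen_sUnion fun v hv => hU.isOpen v (hVU hv)
  -- The points whose whole fibre lies in `⋃₀ V`.
  refine ⟨(π '' (⋃₀ (V : Set (Set Y)))ᶜ)ᶜ, (hπ _ hopen.isClosed_compl).isOpen_compl, ?_, ?_⟩
  · rintro ⟨y, hy, rfl⟩
    exact hy (hxV rfl)
  · refine (coverNumber_le V hVU fun y hy => ?_).trans
      (hV.trans_le (coverNumber_le_fiberCoverNumber hU.finite hU.sUnion_eq π x))
    by_contra hyV
    exact hy ⟨y, hyV, rfl⟩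

/-- Intersecting the neighbourhoods over the finite set `S` makes one cover serve all shapes at
once. -/
theorem exists_cover_coverNumber_le [TopologicalSpace X] [CompactSpace X] [TopologicalSpace Y]
    {π : Y → X} (hπ : IsClosedMap π) {ι : Type*} (S : Finset ι) {U : ι → Set (Set Y)}
    (hU : ∀ i, IsFiniteOpenCover (U i)) :
    ∃ W : Set (Set X), IsFiniteOpenCover W ∧
      ∀ i ∈ S, ∀ w ∈ W, coverNumber (U i) (π ⁻¹' w) ≤ fiberCoverNumber (U i) π := by
  choose O hO hxO hON using fun (x : X) (i : ι) => exists_isOpen_coverNumber_le hπ (hU i) x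
  obtain ⟨t, ht⟩ := isCompact_univ.elim_finite_subcover (fun x => ⋂ i ∈ S, O x i)
    (fun x => isOpen_biInter_finset fun i _ => hO x i)
    (fun x _ => Set.mem_iUnion.2 ⟨x, Set.mem_iInter₂.2 fun i _ => hxO x i⟩)
  refine ⟨(fun x => ⋂ i ∈ S, O x i) '' t, ⟨t.finite_toSet.image _, ?_, ?_⟩, ?_⟩
  · rintro _ ⟨x, -, rfl⟩
    exact isOpen_biInter_finset fun i _ => hO x i
  · rw [Set.sUnion_image]
    exact Set.univ_subset_iff.1 ht
  · rintro i hi _ ⟨x, -, rfl⟩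
    have hsub : ⋂ i ∈ S, O x i ⊆ O x i := Set.biInter_subset_of_mem hi
    exact (coverNumber_le_of_preimage (K' := π ⁻¹' O x i) (hU i).finite (hU i).sUnion_eq id
      (fun v hv => ⟨v, hv, subset_rfl⟩) fun y hy => hsub hy).trans (hON x i)

variable {G : Type*} [Group G] [MulAction G X] [MulAction G Y]

theorem finite_coverJoin {U : Set (Set X)} (hU : U.Finite) (F : Finset G) :
    (coverJoin U F).Finite := by
  have := hU.to_subtype
  refine (Set.finite_range fun u : F → U => ⋂ g : F, (fun x : X => (g : G) • x) ⁻¹' (u g)).subset ?_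
  rintro _ ⟨u, hu, rfl⟩
  exact ⟨fun g => ⟨u g, hu g g.2⟩, by simp [Set.iInter_subtype]⟩

theorem sUnion_coverJoin {U : Set (Set X)} (hU : ⋃₀ U = Set.univ) (F : Finset G) :
    ⋃₀ coverJoin U F = Set.univ := by
  refine Set.eq_univ_of_forall fun x => ?_
  choose u hu hx using fun g : G => Set.mem_sUnion.1 (hU ▸ Set.mem_univ (g • x))
  exact ⟨_, ⟨u, fun g _ => hu g, rfl⟩, Set.mem_iInter₂.2 fun g _ => hx g⟩

theorem IsFiniteOpenCover.coverJoin [TopologicalSpace X] [ContinuousConstSMul G X]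
    {U : Set (Set X)} (hU : IsFiniteOpenCover U) (F : Finset G) :
    IsFiniteOpenCover (coverJoin U F) where
  finite := finite_coverJoin hU.finite F
  isOpen := by
    rintro _ ⟨u, hu, rfl⟩
    exact isOpen_biInter_finset fun g hg =>
      (hU.isOpen _ (hu g hg)).preimage (continuous_const_smul g)
  sUnion_eq := sUnion_coverJoin hU.sUnion_eq F

theorem coverNumber_coverJoin_union_le [DecidableEq G] {U : Set (Set X)} (hU : U.Finite)
    (hUc : ⋃₀ U = Set.univ) (A B : Finset G) (K : Set X) :
    coverNumber (coverJoin U (A ∪ B)) K ≤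
      coverNumber (coverJoin U A) K * coverNumber (coverJoin U B) K := by
  refine coverNumber_le_mul (finite_coverJoin hU A) (sUnion_coverJoin hUc A)
    (finite_coverJoin hU B) (sUnion_coverJoin hUc B) ?_ K
  rintro _ ⟨u, hu, rfl⟩ _ ⟨v, hv, rfl⟩
  refine ⟨_, ⟨fun g => if g ∈ A then u g else v g, fun g hg => ?_, rfl⟩, ?_⟩
  · by_cases hgA : g ∈ A
    · simpa [hgA] using hu g hgA
    · simpa [hgA] using hv g ((Finset.mem_union.1 hg).resolve_left hgA)
  · rintro x ⟨hxu, hxv⟩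
    refine Set.mem_iInter₂.2 fun g hg => ?_
    by_cases hgA : g ∈ A
    · simpa [hgA] using Set.mem_iInter₂.1 hxu g hgA
    · simpa [hgA] using
        Set.mem_iInter₂.1 hxv g ((Finset.mem_union.1 hg).resolve_left hgA)

theorem log_coverNumber_coverJoin_union_le [DecidableEq G] {U : Set (Set X)} (hU : U.Finite)
    (hUc : ⋃₀ U = Set.univ) (A B : Finset G) (K : Set X) :
    Real.log (coverNumber (coverJoin U (A ∪ B)) K) ≤
      Real.log (coverNumber (coverJoin U A) K) + Real.log (coverNumber (coverJoin U B) K) := by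
  have h := coverNumber_coverJoin_union_le hU hUc A B K
  rcases Nat.eq_zero_or_pos (coverNumber (coverJoin U (A ∪ B)) K) with h0 | h0
  -- The cover number vanishes when `K` is empty; then `Real.log 0 = 0`.
  · rw [h0, Nat.cast_zero, Real.log_zero]
    exact add_nonneg (Real.log_natCast_nonneg _) (Real.log_natCast_nonneg _)
  · have hpos := h0.trans_le h
    rw [← Real.log_mul (by exact_mod_cast (Nat.pos_of_mul_pos_right hpos).ne')
      (by exact_mod_cast (Nat.pos_of_mul_pos_left hpos).ne')]
    exact Real.log_le_log (by exact_mod_cast h0) (by exact_mod_cast h)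

theorem log_natCast_le_log_natCast {m n : ℕ} (h : m ≤ n) : Real.log m ≤ Real.log n := by
  rcases Nat.eq_zero_or_pos m with rfl | hm
  · simpa using Real.log_natCast_nonneg n
  · exact Real.log_le_log (by exact_mod_cast hm) (by exact_mod_cast h)

/-- The translate by `c` of the join along `A` is the join along `A c`. -/
theorem coverNumber_coverJoin_mul_singleton_le [DecidableEq G] {U : Set (Set X)} (hU : U.Finite)
    (hUc : ⋃₀ U = Set.univ) (A : Finset G) (c : G) {K K' : Set X}
    (hK : K ⊆ (fun x => c • x) ⁻¹' K') :
    coverNumber (coverJoin U (A * {c})) K ≤ coverNumber (coverJoin U A) K' := by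
  refine coverNumber_le_of_preimage (finite_coverJoin hU A) (sUnion_coverJoin hUc A)
    (fun x => c • x) ?_ hK
  rintro _ ⟨u, hu, rfl⟩
  refine ⟨_, ⟨fun g => u (g * c⁻¹), fun g hg => ?_, rfl⟩, fun x hx => ?_⟩
  · obtain ⟨a, ha, d, hd, rfl⟩ := Finset.mem_mul.1 hg
    obtain rfl := Finset.mem_singleton.1 hd
    simpa using hu a ha
  · refine Set.mem_iInter₂.2 fun g hg => ?_
    obtain ⟨a, ha, d, hd, rfl⟩ := Finset.mem_mul.1 hg
    obtain rfl := Finset.mem_singleton.1 hd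
    simpa [mul_smul] using Set.mem_iInter₂.1 hx a ha

theorem log_coverNumber_coverJoin_le [DecidableEq G] {U : Set (Set X)} (hU : U.Finite)
    (hUc : ⋃₀ U = Set.univ) (A : Finset G) (K : Set X) :
    Real.log (coverNumber (coverJoin U A) K) ≤ Real.log U.ncard * A.card := by
  induction A using Finset.induction_on with
  | empty =>
    have h : coverNumber (coverJoin U (∅ : Finset G)) K ≤ 1 :=
      coverNumber_le {Set.univ}
        (by
          intro w hw
          have hw : w = Set.univ := by simpa using hw
          exact ⟨fun _ => ∅, by simp, by simp [hw]⟩)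
        (by simp)
    simpa using log_natCast_le_log_natCast h
  | insert g A hg ih =>
    have h1 : coverNumber (coverJoin U {g}) K ≤ U.ncard :=
      (coverNumber_le_of_preimage (U := coverJoin U {g}) (K := K) (K' := Set.univ) hU hUc
        (fun x => g • x)
        (fun v hv => ⟨(fun x => g • x) ⁻¹' v, ⟨fun _ => v, fun _ _ => hv, by simp⟩, subset_rfl⟩)
        (by simp)).trans
          (coverNumber_le_ncard hU hUc _)
    rw [Finset.insert_eq, Finset.card_union_of_disjoint (by simpa using hg)]
    have h2 := log_coverNumber_coverJoin_union_le hU hUc {g} A K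
    have h3 := log_natCast_le_log_natCast h1
    push_cast [Finset.card_singleton]
    linarith

end Covers

/-! ### Entropy inequalities. -/

section Entropy

variable {G X Y : Type*} [Group G] [TopologicalSpace X] [MulAction G X]
  [TopologicalSpace Y] [MulAction G Y]

/-- Excludes the value `⊥`, which would spoil addition in `EReal`. -/
theorem subsetEntropy_nonneg (F : ℕ → Finset G) (K : Set X) : 0 ≤ subsetEntropy F K := by
  have hU : IsFiniteOpenCover ({Set.univ} : Set (Set X)) := ⟨by simp, by simp, by simp⟩
  refine le_trans ?_ (le_iSup₂ (f := fun U (_ : IsFiniteOpenCover U) => subsetCoverEntropy F U K)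
    _ hU)
  refine le_trans (b := limsup (fun _ : ℕ => (0 : EReal)) atTop) (by simp) (limsup_le_limsup
    (Eventually.of_forall fun n => ?_))
  exact EReal.coe_nonneg.2 (div_nonneg (Real.log_natCast_nonneg _) (Nat.cast_nonneg _))

theorem relEntropy_nonneg {X : Type*} (F : ℕ → Finset G) (π : Y → X) : 0 ≤ relEntropy F π := by
  have hU : IsFiniteOpenCover ({Set.univ} : Set (Set Y)) := ⟨by simp, by simp, by simp⟩
  refine le_trans ?_ (le_iSup₂ (f := fun U (_ : IsFiniteOpenCover U) => relCoverEntropy F U π)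
    _ hU)
  refine le_trans (b := limsup (fun _ : ℕ => (0 : EReal)) atTop) (by simp) (limsup_le_limsup
    (Eventually.of_forall fun n => ?_))
  exact EReal.coe_nonneg.2 (div_nonneg (Real.log_natCast_nonneg _) (Nat.cast_nonneg _))

variable [CompactSpace X] [ContinuousConstSMul G Y]

/-- The core of the argument: `W` and the threshold for `m` are independent of `K`. -/
theorem exists_cover_eventually_log_coverNumber_le {π : Y → X} (hπ : IsClosedMap π)
    (hmap : ∀ (g : G) (y : Y), π (g • y) = g • π y) {F : ℕ → Finset G} (hF : IsFolner F)
    {U : Set (Set Y)} (hU : IsFiniteOpenCover U) {a b : ℝ} (ha0 : 0 ≤ a) (hab : a < b)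
    (ha : relCoverEntropy F U π < a) :
    ∃ W : Set (Set X), IsFiniteOpenCover W ∧ ∀ᶠ m in atTop, ∀ K : Set Y,
      Real.log (coverNumber (coverJoin U (F m)) K) ≤
        Real.log (coverNumber (coverJoin W (F m)) (π '' K)) + b * (F m).card := by
  classical
  set L := Real.log U.ncard
  have hL : 0 ≤ L := Real.log_natCast_nonneg _
  have hpos : ∀ n, (0 : ℝ) < (F n).card := fun n => by exact_mod_cast (hF.nonempty n).card_pos
  obtain ⟨n₀, hn₀⟩ := eventually_atTop.1 (eventually_lt_of_limsup_lt ha)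
  obtain ⟨ε, hε, hε2, hεb⟩ : ∃ ε : ℝ, 0 < ε ∧ ε ≤ 1 / 2 ∧ a * (1 + 2 * ε) + L * ε ≤ b := by
    have hba : 0 < b - a := sub_pos.2 hab
    have hden : 0 < 2 * a + L + 1 := by positivity
    -- The tiling loss is `ε * (2 * a + L)`, which must fit into `b - a`; the `1` keeps the
    -- denominator positive.
    refine ⟨min (1 / 2) ((b - a) / (2 * a + L + 1)), by positivity, min_le_left _ _, ?_⟩
    set ε := min (1 / 2) ((b - a) / (2 * a + L + 1))
    have hε : 0 < ε := by positivity
    have h := (le_div_iff₀ hden).1 (min_le_right (1 / 2) ((b - a) / (2 * a + L + 1)))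
    change ε * _ ≤ _ at h
    linarith
  obtain ⟨S, hS, hev⟩ := hF.exists_eventually_subadditive_le n₀ hε hε2
  obtain ⟨W, hW, hWS⟩ := exists_cover_coverNumber_le hπ S fun n => hU.coverJoin (F n)
  refine ⟨W, hW, hev.mono fun m hm K => ?_⟩
  have hWF : ∀ w ∈ coverJoin W (F m),
      Real.log (coverNumber (coverJoin U (F m)) (π ⁻¹' w)) ≤ b * (F m).card := by
    rintro _ ⟨u, hu, rfl⟩
    -- Quasi-tiling applied to `φ A = log N(U_A, π⁻¹ w)` for this fixed `w`.
    refine (hm (fun A => Real.log (coverNumber (coverJoin U A) _)) a L ha0 hL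
      (fun A B => log_coverNumber_coverJoin_union_le hU.finite hU.sUnion_eq A B _)
      (fun A => log_coverNumber_coverJoin_le hU.finite hU.sUnion_eq A _)
      fun n hn c hc => ?_).trans (mul_le_mul_of_nonneg_right hεb (hpos m).le)
    have h1 := hn₀ n (hS n hn)
    rw [EReal.coe_lt_coe_iff, div_lt_iff₀ (hpos n)] at h1
    refine (log_natCast_le_log_natCast ?_).trans h1.le
    refine (coverNumber_coverJoin_mul_singleton_le (K' := π ⁻¹' (u c)) hU.finite hU.sUnion_eq
      (F n) c fun y hy => ?_).trans (hWS n hn (u c) (hu c hc))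
    simpa [hmap] using Set.mem_iInter₂.1 hy c hc
  have hb0 : 0 ≤ b * (F m).card := mul_nonneg (ha0.trans hab.le) (hpos m).le
  have hN : coverNumber (coverJoin U (F m)) K ≤
      coverNumber (coverJoin W (F m)) (π '' K) * ⌊Real.exp (b * (F m).card)⌋₊ := by
    refine coverNumber_le_mul_of_preimage (finite_coverJoin hU.finite _)
      (sUnion_coverJoin hU.sUnion_eq _) (finite_coverJoin hW.finite _)
      (sUnion_coverJoin hW.sUnion_eq _) π (fun w hw => Nat.le_floor ?_) K
    rcases Nat.eq_zero_or_pos (coverNumber (coverJoin U (F m)) (π ⁻¹' w)) with h0 | h0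
    · rw [h0, Nat.cast_zero]
      exact (Real.exp_pos _).le
    · exact (Real.log_le_iff_le_exp (by exact_mod_cast h0)).1 (hWF w hw)
  have hN' : (coverNumber (coverJoin U (F m)) K : ℝ) ≤
      coverNumber (coverJoin W (F m)) (π '' K) * Real.exp (b * (F m).card) := by
    refine (Nat.cast_le.2 hN).trans ?_
    push_cast
    exact mul_le_mul_of_nonneg_left (Nat.floor_le (Real.exp_pos _).le) (Nat.cast_nonneg _)
  rcases Nat.eq_zero_or_pos (coverNumber (coverJoin U (F m)) K) with h0 | h0
  · rw [h0, Nat.cast_zero, Real.log_zero]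
    exact add_nonneg (Real.log_natCast_nonneg _) hb0
  · have h0' : (0 : ℝ) < coverNumber (coverJoin U (F m)) K := by exact_mod_cast h0
    have hne : (coverNumber (coverJoin W (F m)) (π '' K) : ℝ) ≠ 0 := by
      intro h
      rw [h, zero_mul] at hN'
      linarith
    have h := Real.log_le_log h0' hN'
    rwa [Real.log_mul hne (Real.exp_pos _).ne', Real.log_exp] at h

/-- Bowen's inequality for subsets. -/
theorem subsetEntropy_le_add_relEntropy {π : Y → X} (hπ : IsClosedMap π)
    (hmap : ∀ (g : G) (y : Y), π (g • y) = g • π y) {F : ℕ → Finset G} (hF : IsFolner F)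
    (K : Set Y) : subsetEntropy F K ≤ subsetEntropy F (π '' K) + relEntropy F π := by
  have hS := (EReal.bot_lt_zero.trans_le (subsetEntropy_nonneg F (π '' K))).ne'
  have hR := relEntropy_nonneg F π
  refine iSup₂_le fun U hU => ?_
  -- Both summands are approached strictly from above, leaving room for reals `a < b` between
  -- `relEntropy F π` and `b'`.
  refine EReal.le_add_of_forall_gt (.inl hS) (.inr (EReal.bot_lt_zero.trans_le hR).ne')
    fun s hs b' hb' => ?_
  obtain ⟨b, hb, hbb'⟩ := EReal.lt_iff_exists_real_btwn.1 hb'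
  obtain ⟨a, ha, hab⟩ := EReal.lt_iff_exists_real_btwn.1 hb
  have ha0 : 0 ≤ a := by exact_mod_cast (hR.trans ha.le)
  obtain ⟨W, hW, hev⟩ := exists_cover_eventually_log_coverNumber_le hπ hmap hF hU ha0
    (EReal.coe_lt_coe_iff.1 hab) ((le_iSup₂ (f := fun U (_ : IsFiniteOpenCover U) =>
      relCoverEntropy F U π) U hU).trans_lt ha)
  have hWs : subsetCoverEntropy F W (π '' K) < s :=
    (le_iSup₂ (f := fun W (_ : IsFiniteOpenCover W) => subsetCoverEntropy F W (π '' K))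
      W hW).trans_lt hs
  refine le_trans (limsup_le_limsup (hev.mono fun m hm => ?_))
    ((EReal.limsup_add_le_of_le (v := fun _ : ℕ => (b : EReal)) hWs (by simp)).trans
      (add_le_add le_rfl hbb'.le))
  have hpos : (0 : ℝ) < (F m).card := by exact_mod_cast (hF.nonempty m).card_pos
  rw [Pi.add_apply, ← EReal.coe_add, EReal.coe_le_coe_iff, div_add' _ _ _ hpos.ne']
  exact div_le_div_of_nonneg_right (hm K) hpos.le

end Entropy

end GSystem

theorem mainTheorem5 {G X Y : Type*} [Group G] [Countable G] [Infinite G]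
    [MetricSpace X] [CompactSpace X] [MulAction G X] [ContinuousConstSMul G X]
    [MetricSpace Y] [CompactSpace Y] [MulAction G Y] [ContinuousConstSMul G Y]
    (π : Y → X) (hπ : GSystem.IsFactorMap G π)
    (F : ℕ → Finset G) (hF : GSystem.IsFolner F)
    (hX : GSystem.topEntropy F X < ⊤) :
    GSystem.topEntropy F Y ≤ GSystem.topEntropy F X + GSystem.relEntropy F π ∧
    (GSystem.IsTempered F → ∀ K : Set Y, K.Nonempty → IsCompact K →
      GSystem.subsetEntropy F K ≤
        GSystem.subsetEntropy F (π '' K) + GSystem.relEntropy F π) := by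
  have h := GSystem.subsetEntropy_le_add_relEntropy hπ.continuous.isClosedMap hπ.map_smul hF
  refine ⟨?_, fun _ K _ _ => h K⟩
  simpa [GSystem.topEntropy, Set.image_univ, hπ.surjective.range_eq] using h Set.univ
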